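/- Let $F$ be an algebraically closed field of characteristic $0$, let $n,m\ge 1$, and let $R=M_{n,m}(F)$ be the matrix superalgebra: the algebra of block matrices $\begin{pmatrix}A&B\\C&D\end{pmatrix}$ over $F$ with $A$ of size $n\times n$ and $D$ of size $m\times m$, with even part $R_{\bar 0}=\{B=0,\ C=0\}$ and odd part $R_{\bar 1}=\{A=0,\ D=0\}$. Let $*$ be a superinvolution on $R$, that is, an $F$-linear map $*:R\to R$ with $(R_{\bar\imath})^*\subseteq R_{\bar\imath}$ for $\bar\imath\in\{\bar 0,\bar 1\}$, $(a^*)^*=a$ for all $a\in R$, and $(ab)^*=(-1)^{|a||b|}b^*a^*$ for all homogeneous $a,b\in R$ (of parities $|a|,|b|$). Let $G$ be a finite abelian group. Then there is no $G$-grading $R=\bigoplus_{g\in G}R_g$ of the algebra $R$ such that 1. $R_g=(R_g\cap R_{\bar 0})\oplus(R_g\cap R_{\bar 1})$ for every $g\in G$ (the grading is compatible with the superalgebra structure); 2. $(R_g)^*=R_g$ for every $g\in G$ (the grading is compatible with $*$); 3. $\dim_F R_g=1$ for every $g\in G$ with $R_g\neq\{0\}$ (the grading is fine). -/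

import Mathlib

/-- The underlying algebra of the matrix superalgebra `M_{n,m}(F)`: block matrices
`(A B; C D)` with `A` of size `n × n` and `D` of size `m × m`. -/
abbrev MatSuper (n m : ℕ) (F : Type*) : Type _ :=
  Matrix (Fin n ⊕ Fin m) (Fin n ⊕ Fin m) F

/-- The parity of a row or column index: `0` for the first `n`, `1` for the last `m`. -/
def indexParity (n m : ℕ) : Fin n ⊕ Fin m → ZMod 2 :=
  Sum.elim (fun _ => 0) (fun _ => 1)

/-- The homogeneous components of the superalgebra `M_{n,m}(F)`: the component of parity `0`
consists of the block-diagonal matrices (`B = 0`, `C = 0`), the component of parity `1` of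
those with `A = 0`, `D = 0`. -/
def superPart (F : Type*) [Field F] (n m : ℕ) (i : ZMod 2) :
    Submodule F (MatSuper n m F) where
  carrier := {X | ∀ a b, indexParity n m a + indexParity n m b ≠ i → X a b = 0}
  zero_mem' := fun _ _ _ => rfl
  add_mem' := by
    intro X Y hX hY a b h
    simp [hX a b h, hY a b h]
  smul_mem' := by
    intro c X hX a b h
    simp [hX a b h]

section

variable {F R : Type*} [Field F] [Ring R] [Algebra F R]

/-- A superinvolution of the superalgebra `R = P 0 ⊕ P 1`: a linear map that preserves parity,
is its own inverse, and satisfies `(a b)^* = (-1)^{|a||b|} b^* a^*` for homogeneous `a`, `b`. -/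
structure IsSuperinvolution (P : ZMod 2 → Submodule F R) (s : R →ₗ[F] R) : Prop where
  map_mem : ∀ (i : ZMod 2) (a : R), a ∈ P i → s a ∈ P i
  involutive : ∀ a : R, s (s a) = a
  map_mul : ∀ (i j : ZMod 2) (a b : R), a ∈ P i → b ∈ P j →
    s (a * b) = (-1 : R) ^ (i.val * j.val) * (s b * s a)

/-- The family `𝒜` is compatible with the superalgebra structure `R = P 0 ⊕ P 1`: each
component is a graded subspace, `R_g = (R_g ∩ R_0) ⊕ (R_g ∩ R_1)`. -/
def IsSuperGrading {G : Type*} (P : ZMod 2 → Submodule F R) (𝒜 : G → Submodule F R) : Prop :=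
  ∀ g, 𝒜 g = (𝒜 g ⊓ P 0) ⊔ (𝒜 g ⊓ P 1)

/-- The map `s` is graded: `(R_g)^* = R_g` for every `g`. -/
def IsGradedMap {G : Type*} (𝒜 : G → Submodule F R) (s : R →ₗ[F] R) : Prop :=
  ∀ g, (𝒜 g).map s = 𝒜 g

/-- A fine grading: each nonzero component has dimension one. -/
def IsFineGrading {G : Type*} (𝒜 : G → Submodule F R) : Prop :=
  ∀ g, 𝒜 g ≠ ⊥ → Module.finrank F (𝒜 g) = 1

end

/-!
The idea is that an odd homogeneous element `x` of such a grading squares to zero, which forces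
`x = 0`, although the odd part of `M_{n,m}(F)` is nonzero.

Since each component is at most one-dimensional, every element `v` of a component has a parity and
satisfies `s v = ± v`. Comparing `s (x * y) = ± x * y` with `s (x * y) = ± s y * s x` shows that
homogeneous elements commute up to sign (`mul_eq_or_eq_neg_of_mem`). Hence the square of a
homogeneous `x` commutes with all homogeneous elements, so it is central and therefore equal to a
scalar matrix, which `s` fixes. If `x` is odd, then also `s (x * x) = -(s x * s x) = -(x * x)`, so
`x * x = 0`. Commuting `x` past homogeneous `y` once more gives `x * y * x = 0` for all `y`, and
`x = 0` because a matrix algebra is a prime ring (`matrix_eq_zero_of_forall_mul_mul_eq_zero`).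
-/

section

variable {F R G : Type*} [Field F] [Ring R] [Algebra F R]

theorem IsFineGrading.exists_smul_eq {𝒜 : G → Submodule F R} (hf : IsFineGrading 𝒜) {g : G}
    {v w : R} (hv : v ∈ 𝒜 g) (hw : w ∈ 𝒜 g) (hv0 : v ≠ 0) : ∃ c : F, c • v = w := by
  have hne : 𝒜 g ≠ ⊥ := fun h => hv0 ((Submodule.mem_bot F).1 (h ▸ hv))
  obtain ⟨c, hc⟩ := (finrank_eq_one_iff_of_nonzero' (⟨v, hv⟩ : 𝒜 g)
    (fun h => hv0 (congrArg Subtype.val h))).1 (hf g hne) ⟨w, hw⟩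
  exact ⟨c, congrArg Subtype.val hc⟩

theorem IsSuperGrading.exists_mem {P : ZMod 2 → Submodule F R} {𝒜 : G → Submodule F R}
    (hg : IsSuperGrading P 𝒜) (hf : IsFineGrading 𝒜) {g : G} {v : R} (hv : v ∈ 𝒜 g) :
    ∃ i, v ∈ P i := by
  have h := hv
  rw [hg g] at h
  obtain ⟨a, ha, b, hb, rfl⟩ := Submodule.mem_sup.1 h
  by_cases ha0 : a = 0
  · exact ⟨1, by simpa [ha0] using hb.2⟩
  · obtain ⟨c, hc⟩ := hf.exists_smul_eq ha.1 hv ha0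
    exact ⟨0, hc ▸ (P 0).smul_mem c ha.2⟩

theorem IsSuperinvolution.map_eq_or_eq_neg {P : ZMod 2 → Submodule F R} {s : R →ₗ[F] R}
    (hs : IsSuperinvolution P s) {𝒜 : G → Submodule F R} (hsg : IsGradedMap 𝒜 s)
    (hf : IsFineGrading 𝒜) {g : G} {v : R} (hv : v ∈ 𝒜 g) : s v = v ∨ s v = -v := by
  by_cases hv0 : v = 0
  · simp [hv0]
  have hsv : s v ∈ 𝒜 g := by
    rw [← hsg g]
    exact Submodule.mem_map_of_mem hv
  obtain ⟨c, hc⟩ := hf.exists_smul_eq hv hsv hv0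
  have hcc : (c * c - 1) • v = 0 := by
    have h := hs.involutive v
    rw [← hc, map_smul, ← hc, smul_smul] at h
    rw [sub_smul, h, one_smul, sub_self]
  rcases mul_self_eq_one_iff.1 (sub_eq_zero.1 ((smul_eq_zero.1 hcc).resolve_right hv0)) with h | h
  · left; rw [← hc, h, one_smul]
  · right; rw [← hc, h, neg_smul, one_smul]

theorem IsSuperinvolution.map_mul_eq_or_eq_neg {P : ZMod 2 → Submodule F R} {s : R →ₗ[F] R}
    (hs : IsSuperinvolution P s) {i j : ZMod 2} {a b : R} (ha : a ∈ P i) (hb : b ∈ P j) :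
    s (a * b) = s b * s a ∨ s (a * b) = -(s b * s a) := by
  rw [hs.map_mul i j a b ha hb]
  rcases neg_one_pow_eq_or R (i.val * j.val) with h | h <;> simp [h]

theorem IsSuperinvolution.map_one {P : ZMod 2 → Submodule F R} {s : R →ₗ[F] R}
    (hs : IsSuperinvolution P s) (h1 : (1 : R) ∈ P 0) : s 1 = 1 := by
  have h := hs.map_mul 0 0 1 (s 1) h1 (hs.map_mem 0 1 h1)
  simpa [hs.involutive] using h.symm

/-- Homogeneous elements of a fine grading compatible with a superinvolution commute up to sign. -/
theorem IsSuperinvolution.mul_eq_or_eq_neg_of_mem [AddCommGroup G] [DecidableEq G]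
    {P : ZMod 2 → Submodule F R} {s : R →ₗ[F] R} (hs : IsSuperinvolution P s)
    (𝒜 : G → Submodule F R) [GradedAlgebra 𝒜] (hg : IsSuperGrading P 𝒜) (hsg : IsGradedMap 𝒜 s)
    (hf : IsFineGrading 𝒜) {g h : G} {x y : R} (hx : x ∈ 𝒜 g) (hy : y ∈ 𝒜 h) :
    x * y = y * x ∨ x * y = -(y * x) := by
  obtain ⟨i, hi⟩ := hg.exists_mem hf hx
  obtain ⟨j, hj⟩ := hg.exists_mem hf hy
  have hxy := hs.map_eq_or_eq_neg hsg hf (SetLike.mul_mem_graded hx hy)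
  have hmul := hs.map_mul_eq_or_eq_neg hi hj
  rcases hs.map_eq_or_eq_neg hsg hf hx with h1 | h1 <;>
  rcases hs.map_eq_or_eq_neg hsg hf hy with h2 | h2 <;>
  rcases hxy with h3 | h3 <;> rcases hmul with h4 | h4 <;>
  · rw [h1, h2, h3] at h4
    try simp only [neg_mul, mul_neg, neg_neg, neg_inj] at h4
    first
      | exact Or.inl h4
      | exact Or.inr h4
      | exact Or.inr (neg_eq_iff_eq_neg.1 h4)

end

theorem matrix_eq_zero_of_forall_mul_mul_eq_zero {F ι : Type*} [Field F] [Fintype ι]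
    [DecidableEq ι] {x : Matrix ι ι F} (h : ∀ y, x * y * x = 0) : x = 0 := by
  ext i j
  -- the `(i, j)` entry of `x * E_{ji} * x` is the square of `x i j`
  have := congrFun (congrFun (h (Matrix.single j i 1)) i) j
  simpa [Matrix.mul_assoc, Matrix.mul_apply, Matrix.single_apply, ite_and] using this

theorem one_mem_superPart_zero (F : Type*) [Field F] (n m : ℕ) :
    (1 : MatSuper n m F) ∈ superPart F n m 0 := by
  intro a b h
  refine Matrix.one_apply_ne fun hab => h ?_
  rw [hab]
  exact CharTwo.add_self_eq_zero _

theorem superPart_zero_ne_top (F : Type*) [Field F] {n m : ℕ} (hn : 0 < n) (hm : 0 < m) :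
    superPart F n m 0 ≠ ⊤ := by
  intro h
  have hmem : Matrix.single (Sum.inl ⟨0, hn⟩) (Sum.inr ⟨0, hm⟩) (1 : F) ∈ superPart F n m 0 :=
    h ▸ Submodule.mem_top
  have := hmem (Sum.inl ⟨0, hn⟩) (Sum.inr ⟨0, hm⟩) (by simp [indexParity])
  simp at this

theorem theorem4p3 {F : Type*} [Field F] [IsAlgClosed F] [CharZero F]
    {n m : ℕ} (hn : 0 < n) (hm : 0 < m)
    {G : Type*} [AddCommGroup G] [Finite G] [DecidableEq G]
    (s : MatSuper n m F →ₗ[F] MatSuper n m F)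
    (hs : IsSuperinvolution (superPart F n m) s) :
    ¬ ∃ (𝒜 : G → Submodule F (MatSuper n m F)),
        Nonempty (GradedAlgebra 𝒜) ∧ IsSuperGrading (superPart F n m) 𝒜 ∧
        IsGradedMap 𝒜 s ∧ IsFineGrading 𝒜 := by
  rintro ⟨𝒜, ⟨_⟩, hg, hsg, hf⟩
  have odd_eq_zero : ∀ (g : G) (x : MatSuper n m F), x ∈ 𝒜 g → x ∈ superPart F n m 1 → x = 0 := by
    intro g x hx hodd
    have hcomm : ∀ (h : G) (y : MatSuper n m F), y ∈ 𝒜 h → x * y = y * x ∨ x * y = -(y * x) :=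
      fun h y hy => hs.mul_eq_or_eq_neg_of_mem 𝒜 hg hsg hf hx hy
    have hcentral : ∀ y, x * x * y = y * (x * x) := by
      intro y
      induction y using DirectSum.Decomposition.inductionOn 𝒜 with
      | zero => simp
      | @homogeneous h y =>
        rcases hcomm h y y.2 with e | e
        · rw [mul_assoc, e, ← mul_assoc, e, mul_assoc]
        · rw [mul_assoc, e, mul_neg, ← mul_assoc, e, neg_mul, neg_neg, mul_assoc]
      | add a b ha hb => rw [mul_add, add_mul, ha, hb]
    obtain ⟨c, hc⟩ : ∃ c : F, c • (1 : MatSuper n m F) = x * x := by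
      obtain ⟨c, hc⟩ := Matrix.mem_range_scalar_of_commute_single (M := x * x)
        fun i j _ => (hcentral (Matrix.single i j 1)).symm
      exact ⟨c, by rw [← hc, Matrix.smul_one_eq_diagonal]; rfl⟩
    have hfix : s (x * x) = x * x := by
      rw [← hc, map_smul, hs.map_one (one_mem_superPart_zero F n m)]
    have hneg : s (x * x) = -(x * x) := by
      have h := hs.map_mul 1 1 x x hodd hodd
      rcases hs.map_eq_or_eq_neg hsg hf hx with e | e <;> simpa [e, ZMod.val_one] using h
    have hsq : x * x = 0 := by
      ext i j
      exact self_eq_neg.1 (congrFun (congrFun (hfix.symm.trans hneg) i) j)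
    refine matrix_eq_zero_of_forall_mul_mul_eq_zero fun y => ?_
    induction y using DirectSum.Decomposition.inductionOn 𝒜 with
    | zero => simp
    | @homogeneous h y =>
      rcases hcomm h y y.2 with e | e <;> simp [e, mul_assoc, hsq]
    | add a b ha hb => rw [mul_add, add_mul, ha, hb, add_zero]
  refine superPart_zero_ne_top F hn hm (eq_top_iff.2 fun y _ => ?_)
  induction y using DirectSum.Decomposition.inductionOn 𝒜 with
  | zero => exact Submodule.zero_mem _
  | @homogeneous h y =>
    obtain ⟨a, ha, b, hb, hab⟩ := Submodule.mem_sup.1 ((hg h).le y.2)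
    rw [← hab, odd_eq_zero h b hb.1 hb.2, add_zero]
    exact ha.2
  | add a b ha hb => exact Submodule.add_mem _ (ha trivial) (hb trivial)
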